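/- Let $M$, $\Theta$ and $X$ be compact (Hausdorff, finite-dimensional, $C^\infty$) manifolds without boundary, let $\pi\colon M\to\Theta$ be a smooth fibre bundle with typical fibre $X$, and let $f\colon M\to\mathbb{R}$ be a smooth function. A point $p\in M$ is a \emph{fibre-wise critical point} of $f$ if it is a critical point of the restriction $f|_{\pi^{-1}(\pi(p))}$ of $f$ to the fibre containing $p$; it is \emph{non-degenerate} if the Hessian of $f|_{\pi^{-1}(\pi(p))}$ at $p$ is non-singular. Suppose that $f$ is \emph{fibre-wise Morse}, that is, all its fibre-wise critical points are non-degenerate. Then the set $N\subseteq M$ of fibre-wise critical points of $f$ is an embedded smooth submanifold of $M$ with $\dim N=\dim\Theta$, and $N$ intersects every fibre transversally: for every $\theta\in\Theta$ and every $p\in N\cap\pi^{-1}(\theta)$, $$T_pN+T_p\bigl(\pi^{-1}(\theta)\bigr)=T_pM .$$ -/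

import Mathlib

open scoped Manifold ContDiff Topology

noncomputable section

namespace FibreMorse

section SingleManifold

variable {E : Type*} [NormedAddCommGroup E] [NormedSpace ℝ E]
  {H : Type*} [TopologicalSpace H] (I : ModelWithCorners ℝ E H)
  {X : Type*} [TopologicalSpace X] [ChartedSpace H X]

/-- `x` is a critical point of the function `h` on the manifold `X`: the differential of `h`
vanishes at `x` (used only for smooth `h`). -/
def IsCriticalPoint (h : X → ℝ) (x : X) : Prop :=
  mfderiv I 𝓘(ℝ, ℝ) h x = 0

/-- The Hessian of `h` at `x`, expressed in the preferred chart at `x`: the second derivative of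
the local representative of `h`, as a bilinear form on the model vector space (which is the
tangent space at `x`). At a critical point of a smooth function on a manifold without boundary,
this is the intrinsic Hessian. -/
def hessian (h : X → ℝ) (x : X) : E →L[ℝ] E →L[ℝ] ℝ :=
  fderiv ℝ (fderiv ℝ (h ∘ (extChartAt I x).symm)) (extChartAt I x x)

/-- The Hessian of `h` at `x` is non-singular, as a bilinear form on a finite-dimensional
space. -/
def HasNonsingularHessian (h : X → ℝ) (x : X) : Prop :=
  ∀ v : E, (∀ w : E, hessian I h x v w = 0) → v = 0

end SingleManifold

section Bundle

variable {EM : Type*} [NormedAddCommGroup EM] [NormedSpace ℝ EM]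
  {HM : Type*} [TopologicalSpace HM] (IM : ModelWithCorners ℝ EM HM)
  {EB : Type*} [NormedAddCommGroup EB] [NormedSpace ℝ EB]
  {HB : Type*} [TopologicalSpace HB] (IB : ModelWithCorners ℝ EB HB)
  {EX : Type*} [NormedAddCommGroup EX] [NormedSpace ℝ EX]
  {HX : Type*} [TopologicalSpace HX] (IX : ModelWithCorners ℝ EX HX)
  {M : Type*} [TopologicalSpace M] [ChartedSpace HM M]
  {B : Type*} [TopologicalSpace B] [ChartedSpace HB B]
  {X : Type*} [TopologicalSpace X] [ChartedSpace HX X]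
  {π : M → B}

/-- A local trivialisation `π⁻¹(U) ≃ U × X` over an open set `U = e.baseSet` is smooth if it is a
diffeomorphism. -/
structure IsSmoothTrivialization (e : Bundle.Trivialization X π) : Prop where
  contMDiffOn_toFun : ContMDiffOn IM (IB.prod IX) ∞ e.toOpenPartialHomeomorph e.source
  contMDiffOn_symm : ContMDiffOn (IB.prod IX) IM ∞ e.toOpenPartialHomeomorph.symm e.target

variable (X π) in
/-- `π : M → B` is a smooth fibre bundle with typical fibre `X`: it is smooth, and every point of
the base lies in an open set over which there is a smooth local trivialisation. -/
structure IsSmoothFibreBundle : Prop where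
  contMDiff : ContMDiff IM IB ∞ π
  exists_trivialization : ∀ b : B, ∃ e : Bundle.Trivialization X π,
    b ∈ e.baseSet ∧ IsSmoothTrivialization IM IB IX e

/-- The diffeomorphism from the typical fibre `X` onto the fibre `π⁻¹(b)` given by a local
trivialisation `e` over a neighbourhood of `b`, viewed as a map into `M`. -/
def fibreParam (e : Bundle.Trivialization X π) (b : B) (x : X) : M :=
  e.toOpenPartialHomeomorph.symm (b, x)

variable (X π) in
/-- `p` is a fibre-wise critical point of `f`: it is a critical point of the restriction of `f`
to the fibre `π⁻¹(π p)`. The fibre carries the manifold structure for which the maps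
`fibreParam e (π p) : X → π⁻¹(π p)` are diffeomorphisms; the point of `X` corresponding to `p`
is `(e p).2`. The condition does not depend on `e`. -/
def IsFibrewiseCriticalPoint (f : M → ℝ) (p : M) : Prop :=
  ∀ e : Bundle.Trivialization X π, IsSmoothTrivialization IM IB IX e → π p ∈ e.baseSet →
    IsCriticalPoint IX (f ∘ fibreParam e (π p)) (e p).2

variable (X π) in
/-- The Hessian at `p` of the restriction of `f` to the fibre `π⁻¹(π p)` is non-singular. At a
fibre-wise critical point the condition does not depend on `e`. -/
def HasNonsingularFibreHessian (f : M → ℝ) (p : M) : Prop :=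
  ∀ e : Bundle.Trivialization X π, IsSmoothTrivialization IM IB IX e → π p ∈ e.baseSet →
    HasNonsingularHessian IX (f ∘ fibreParam e (π p)) (e p).2

variable (X π) in
/-- The set of fibre-wise critical points of `f`. -/
def fibrewiseCriticalSet (f : M → ℝ) : Set M :=
  {p | IsFibrewiseCriticalPoint IM IB IX X π f p}

variable (X π) in
/-- `f` is fibre-wise Morse: it is smooth and all its fibre-wise critical points are
non-degenerate. -/
structure IsFibrewiseMorse (f : M → ℝ) : Prop where
  contMDiff : ContMDiff IM 𝓘(ℝ, ℝ) ∞ f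
  nondegenerate : ∀ p : M, IsFibrewiseCriticalPoint IM IB IX X π f p →
    HasNonsingularFibreHessian IM IB IX X π f p

variable (π) in
/-- The tangent space at `p` to the fibre of the smooth bundle `π` through `p`, that is, the
vertical space at `p`, as a subspace of the tangent space to `M`. -/
def fibreTangentSpace (p : M) : Submodule ℝ (TangentSpace IM p) :=
  LinearMap.ker (mfderiv IM IB π p).toLinearMap

/-- The tangent space at `p` to a subset `N` of `M` carrying a manifold structure (modelled on
`ℝᵈ`) whose inclusion in `M` is an embedding, as a subspace of the tangent space to `M`. -/
def submanifoldTangentSpace (d : ℕ) (N : Set M) [ChartedSpace (EuclideanSpace ℝ (Fin d)) N]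
    (p : N) : Submodule ℝ (TangentSpace IM (p : M)) :=
  LinearMap.range (mfderiv (𝓡 d) IM (Subtype.val : N → M) p).toLinearMap

end Bundle

end FibreMorse

end

/-! In a local trivialisation with charts of base and fibre, `f` becomes a smooth function `g (u,
v)`, and by the chain rule `N` is the zero set of `∂g/∂v`, whichever trivialisation is used. At a
point of `N` the derivative of `∂g/∂v` along the fibre is the Hessian, which is invertible. So `(u,
v) ↦ (u, ∂g/∂v)` is a local diffeomorphism (`exists_partialDiffeomorph_of_hessian`). It straightens
`N` to the slice where the second component vanishes, and the first component is still a chart of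
the base (`exists_slice_fibrewiseCriticalSet`).

Such slices make `N` an embedded submanifold modelled on the base
(`exists_isSmoothEmbedding_of_slices`). In the same coordinates `u ↦ (u, 0)` is a local section of
`π` with values in `N`. Hence `dπ` maps `T_pN` onto the tangent space of the base, and any tangent
vector differs from one in `T_pN` by a vertical one
(`submanifoldTangentSpace_sup_fibreTangentSpace`). -/

noncomputable section

namespace FibreMorse

/-! ### Charts on a subset that is locally a slice. -/

section Slices

open Set

variable {E W M : Type*} [TopologicalSpace E] [TopologicalSpace W] [Zero W]
  [TopologicalSpace M] {N : Set M}

open Classical in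
/-- The chart of a subset `N` induced by a chart of the ambient space in which `N` is the slice
`E × {0}`. -/
def sliceChart (ψ : OpenPartialHomeomorph M (E × W))
    (h : ∀ q ∈ ψ.source, q ∈ N ↔ (ψ q).2 = 0) (p : N) : OpenPartialHomeomorph N E where
  toFun q := (ψ q).1
  -- Off the target the value is irrelevant; `p` serves as the default.
  invFun y := if hy : (y, (0 : W)) ∈ ψ.target then
    ⟨ψ.symm (y, 0), (h _ (ψ.map_target hy)).2 (by rw [ψ.right_inv hy])⟩ else p
  source := Subtype.val ⁻¹' ψ.source
  target := {y | (y, (0 : W)) ∈ ψ.target}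
  map_source' q hq := by
    have h0 : (ψ q).2 = 0 := (h q hq).1 q.2
    have : ((ψ q).1, (0 : W)) = ψ q := by rw [← h0]
    simpa only [mem_ofPred_eq, this] using ψ.map_source hq
  map_target' y hy := by
    have hy' : (y, (0 : W)) ∈ ψ.target := hy
    simpa only [mem_preimage, dif_pos hy'] using ψ.map_target hy'
  left_inv' q hq := by
    have h0 : (ψ q).2 = 0 := (h q hq).1 q.2
    have : ((ψ q).1, (0 : W)) = ψ q := by rw [← h0]
    ext
    simp only [this, ψ.map_source hq, dif_pos, ψ.left_inv hq]
  right_inv' y hy := by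
    have hy' : (y, (0 : W)) ∈ ψ.target := hy
    simp only [dif_pos hy', ψ.right_inv hy']
  open_source := ψ.open_source.preimage continuous_subtype_val
  open_target := ψ.open_target.preimage (by fun_prop)
  continuousOn_toFun := continuous_fst.comp_continuousOn
    (ψ.continuousOn.comp continuous_subtype_val.continuousOn fun _ hq => hq)
  continuousOn_invFun := by
    rw [Topology.IsInducing.subtypeVal.continuousOn_iff]
    refine (ψ.symm.continuousOn.comp (f := fun y : E => (y, (0 : W)))
      (by fun_prop) fun y hy => hy).congr fun y hy => ?_
    have hy' : (y, (0 : W)) ∈ ψ.target := hy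
    simp only [Function.comp_apply, dif_pos hy']

theorem mem_sliceChart_target {ψ : OpenPartialHomeomorph M (E × W)}
    {h : ∀ q ∈ ψ.source, q ∈ N ↔ (ψ q).2 = 0} {p : N} {y : E} :
    y ∈ (sliceChart ψ h p).target ↔ (y, (0 : W)) ∈ ψ.target := Iff.rfl

theorem coe_sliceChart_symm {ψ : OpenPartialHomeomorph M (E × W)}
    {h : ∀ q ∈ ψ.source, q ∈ N ↔ (ψ q).2 = 0} {p : N} {y : E}
    (hy : (y, (0 : W)) ∈ ψ.target) :
    ((sliceChart ψ h p).symm y : M) = ψ.symm (y, 0) :=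
  congrArg Subtype.val (dif_pos hy)

end Slices

/-! ### From slice charts to embedded submanifolds. -/

section Submanifolds

open Set

variable {E W : Type*} [NormedAddCommGroup E] [NormedSpace ℝ E]
  [NormedAddCommGroup W] [NormedSpace ℝ W]
  {EM : Type*} [NormedAddCommGroup EM] [NormedSpace ℝ EM]
  {HM : Type*} [TopologicalSpace HM] {I : ModelWithCorners ℝ EM HM}
  {M : Type*} [TopologicalSpace M] [ChartedSpace HM M] {N : Set M}
  {n : WithTop ℕ∞}

/-- A continuous linear equivalence, as a partial diffeomorphism defined everywhere. -/
def linearPartialDiffeomorph (n : WithTop ℕ∞) (A : E ≃L[ℝ] W) :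
    PartialDiffeomorph 𝓘(ℝ, E) 𝓘(ℝ, W) E W n where
  toPartialEquiv := A.toEquiv.toPartialEquiv
  open_source := isOpen_univ
  open_target := isOpen_univ
  contMDiffOn_toFun := A.contDiff.contMDiff.contMDiffOn
  contMDiffOn_invFun := A.symm.contDiff.contMDiff.contMDiffOn

/-- A diffeomorphism from an open subset of a boundaryless manifold onto an open subset of its
model vector space is a chart of the maximal atlas. -/
theorem trans_toHomeomorph_symm_mem_maximalAtlas [I.Boundaryless] [IsManifold I n M]
    (Φ : PartialDiffeomorph I 𝓘(ℝ, EM) M EM n) :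
    Φ.toOpenPartialHomeomorph.transHomeomorph I.toHomeomorph.symm ∈
      IsManifold.maximalAtlas I n M := by
  have hI : ContMDiff 𝓘(ℝ, EM) I n I.symm := by
    rw [← contMDiffOn_univ, ← I.range_eq_univ]
    exact I.contMDiffOn_symm
  refine OpenPartialHomeomorph.mem_maximalAtlas_of_contMDiffOn _ ?_ ?_
  · exact hI.comp_contMDiffOn Φ.contMDiffOn_toFun
  · exact Φ.contMDiffOn_invFun.comp I.contMDiff.contMDiffOn fun _ hx => hx

/-- A subset of a boundaryless manifold that is locally a slice `E × {0}` of a chart with values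
in `E × W` is an embedded submanifold modelled on `E`. -/
theorem exists_isSmoothEmbedding_of_slices [I.Boundaryless] [IsManifold I n M] (hn : n ≠ 0)
    (hN : ∀ p ∈ N, ∃ ψ : PartialDiffeomorph I 𝓘(ℝ, E × W) M (E × W) n,
      p ∈ ψ.source ∧ ∀ q ∈ ψ.source, q ∈ N ↔ (ψ q).2 = 0) :
    ∃ _ : ChartedSpace E N, IsManifold 𝓘(ℝ, E) n N ∧
      Manifold.IsSmoothEmbedding 𝓘(ℝ, E) I n (Subtype.val : N → M) := by
  choose ψ hpψ hψ using fun p : N => hN p p.2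
  let φ (p : N) : OpenPartialHomeomorph N E :=
    sliceChart (ψ p).toOpenPartialHomeomorph (hψ p) p
  let cs : ChartedSpace E N :=
    { atlas := range φ
      chartAt := φ
      mem_chart_source := hpψ
      chart_mem_atlas := mem_range_self }
  have hman : IsManifold 𝓘(ℝ, E) n N := by
    refine isManifold_of_contDiffOn _ _ _ ?_
    rintro _ _ ⟨p, rfl⟩ ⟨p', rfl⟩
    rw [← contMDiffOn_iff_contDiffOn]
    have h1 : ContMDiff 𝓘(ℝ, E) 𝓘(ℝ, E × W) n (fun y : E => (y, (0 : W))) :=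
      (contDiff_id.prodMk contDiff_const).contMDiff
    have h2 : ContMDiff 𝓘(ℝ, E × W) 𝓘(ℝ, E) n (Prod.fst : E × W → E) :=
      contDiff_fst.contMDiff
    have hsub : ∀ y ∈ 𝓘(ℝ, E).symm ⁻¹' ((φ p).symm ≫ₕ φ p').source ∩ range 𝓘(ℝ, E),
        (y, (0 : W)) ∈ (ψ p).target ∧ ((φ p).symm y : M) ∈ (ψ p').source :=
      fun y hy => hy.1
    -- The transition map factors through `M`, where smoothness is already known.
    have h3 : ContMDiffOn 𝓘(ℝ, E) I n (fun y : E => ((φ p).symm y : M))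
        (𝓘(ℝ, E).symm ⁻¹' ((φ p).symm ≫ₕ φ p').source ∩ range 𝓘(ℝ, E)) :=
      ((ψ p).contMDiffOn_invFun.comp h1.contMDiffOn fun y hy => (hsub y hy).1).congr
        fun y hy => coe_sliceChart_symm (hsub y hy).1
    exact h2.comp_contMDiffOn ((ψ p').contMDiffOn_toFun.comp h3 fun y hy => (hsub y hy).2)
  refine ⟨cs, hman, ?_, Topology.IsEmbedding.subtypeVal⟩
  refine Manifold.IsImmersionOfComplement.isImmersion (F := W) fun p => ?_
  -- The normal form of an immersion needs a linear identification of `E × W` with `EM`. The inverse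
  -- of the differential of `ψ p` supplies one, and in the chart `A ∘ ψ p` the inclusion reads `y ↦
  -- A (y, 0)`.
  let A : (E × W) ≃L[ℝ] EM :=
    (((ψ p).isLocalDiffeomorphAt _ _ _ (hpψ p)).mfderivToContinuousLinearEquiv hn).symm
  let Φ := (ψ p).trans (linearPartialDiffeomorph n A)
  refine Manifold.IsImmersionAtOfComplement.mk_of_continuousAt
    continuous_subtype_val.continuousAt A (φ p)
    (Φ.toOpenPartialHomeomorph.transHomeomorph I.toHomeomorph.symm) (hpψ p)
    ⟨hpψ p, mem_univ _⟩ (IsManifold.chart_mem_maximalAtlas p)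
    (trans_toHomeomorph_symm_mem_maximalAtlas Φ) fun y hy => ?_
  have hy' : (y, (0 : W)) ∈ (ψ p).target := by
    simpa [φ, mem_sliceChart_target] using! hy
  have h1 : ((φ p).symm y : M) = (ψ p).symm (y, 0) := coe_sliceChart_symm hy'
  have h2 : (ψ p) ((ψ p).symm (y, 0)) = (y, 0) := (ψ p).right_inv hy'
  change I (I.symm (A (ψ p ((φ p).symm y : M)))) = A (y, 0)
  rw [h1, h2, I.right_inv (I.range_eq_univ ▸ mem_univ _)]

end Submanifolds

/-! ### Inverse function theorem and the partial differential. -/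

section Calculus

open Set

variable {E E' F : Type*} [NormedAddCommGroup E] [NormedSpace ℝ E]
  [NormedAddCommGroup E'] [NormedSpace ℝ E'] [NormedAddCommGroup F] [NormedSpace ℝ F]
  {n : WithTop ℕ∞}

/-- The inverse function theorem, as a statement about partial diffeomorphisms. -/
theorem exists_partialDiffeomorph_of_hasFDerivAt [CompleteSpace E] (hn : n ≠ 0) {g : E → F}
    {s : Set E} (hs : IsOpen s) (hg : ContDiffOn ℝ n g s) {a : E} (ha : a ∈ s) (A : E ≃L[ℝ] F)
    (hA : HasFDerivAt g (A : E →L[ℝ] F) a) :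
    ∃ Φ : PartialDiffeomorph 𝓘(ℝ, E) 𝓘(ℝ, F) E F n,
      a ∈ Φ.source ∧ Φ.source ⊆ s ∧ ∀ x, Φ x = g x := by
  have hga : ContDiffAt ℝ n g a := hg.contDiffAt (hs.mem_nhds ha)
  -- Keeping the derivative invertible throughout the source makes the inverse `C^n` on the whole
  -- target, not only at `g a`.
  let U : Set E := s ∩ fderiv ℝ g ⁻¹' range ((↑) : (E ≃L[ℝ] F) → E →L[ℝ] F)
  have hU : IsOpen U :=
    (hg.continuousOn_fderiv_of_isOpen hs (ENat.one_le_iff_ne_zero_withTop.2 hn)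
      ).isOpen_inter_preimage hs ContinuousLinearEquiv.isOpen
  have haU : a ∈ U := ⟨ha, A, hA.fderiv.symm⟩
  let φ := (hga.toOpenPartialHomeomorph g hA hn).restrOpen U hU
  have hφU : ∀ x ∈ φ.source, x ∈ U := fun x hx => hx.2
  refine ⟨{ toPartialEquiv := φ.toPartialEquiv
            open_source := φ.open_source
            open_target := φ.open_target
            contMDiffOn_toFun := (hg.mono fun x hx => (hφU x hx).1).contMDiffOn
            contMDiffOn_invFun := ?_ }, ?_, fun x hx => (hφU x hx).1, fun x => rfl⟩
  · refine ContDiffOn.contMDiffOn fun y hy => ContDiffAt.contDiffWithinAt ?_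
    obtain ⟨hys, B, hB⟩ := hφU _ (φ.map_target hy)
    have hd : ContDiffAt ℝ n g (φ.symm y) := hg.contDiffAt (hs.mem_nhds hys)
    refine φ.contDiffAt_symm (f₀' := B) hy ?_ hd
    rw [hB]
    exact (hd.differentiableAt hn).hasFDerivAt
  · exact ⟨hga.mem_toOpenPartialHomeomorph_source hA hn, haU⟩

/-- The differential of `g` in the direction of the second factor. -/
def partialDifferential (g : E × E' → ℝ) (z : E × E') : E' →L[ℝ] ℝ :=
  (fderiv ℝ g z).comp (ContinuousLinearMap.inr ℝ E E')

theorem partialDifferential_eq_fderiv {g : E × E' → ℝ} {u : E} {v : E'}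
    (hg : DifferentiableAt ℝ g (u, v)) :
    partialDifferential g (u, v) = fderiv ℝ (fun v' => g (u, v')) v :=
  (hg.hasFDerivAt.comp v (hasFDerivAt_prodMk_right u v)).fderiv.symm

theorem contDiffOn_partialDifferential {g : E × E' → ℝ} {s : Set (E × E')} (hs : IsOpen s)
    (hg : ContDiffOn ℝ ∞ g s) : ContDiffOn ℝ ∞ (partialDifferential g) s :=
  (hg.fderiv_of_isOpen hs (by simp)).clm_comp contDiffOn_const

/-- If the Hessian of `g (u, ·)` at `v` is nonsingular, then `(u', v') ↦ (u', ∂g/∂v' (u', v'))`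
is a diffeomorphism near `(u, v)`. -/
theorem exists_partialDiffeomorph_of_hessian [FiniteDimensional ℝ E] [FiniteDimensional ℝ E']
    {g : E × E' → ℝ} {s : Set (E × E')} (hs : IsOpen s) (hg : ContDiffOn ℝ ∞ g s)
    {u : E} {v : E'} (huv : (u, v) ∈ s)
    (hess : ∀ w : E', fderiv ℝ (fderiv ℝ fun v' => g (u, v')) v w = 0 → w = 0) :
    ∃ Φ : PartialDiffeomorph 𝓘(ℝ, E × E') 𝓘(ℝ, E × (E' →L[ℝ] ℝ)) (E × E')
        (E × (E' →L[ℝ] ℝ)) ∞,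
      (u, v) ∈ Φ.source ∧ Φ.source ⊆ s ∧ ∀ z, Φ z = (z.1, partialDifferential g z) := by
  have hG := contDiffOn_partialDifferential hs hg
  have hGd := ((hG.contDiffAt (hs.mem_nhds huv)).differentiableAt (by simp)).hasFDerivAt
  set D := fderiv ℝ (partialDifferential g) (u, v)
  let T : (E × E') →L[ℝ] (E × (E' →L[ℝ] ℝ)) := (ContinuousLinearMap.fst ℝ E E').prod D
  have hD : fderiv ℝ (fderiv ℝ fun v' => g (u, v')) v = D.comp (.inr ℝ E E') := by
    rw [← (hGd.comp v (hasFDerivAt_prodMk_right u v)).fderiv]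
    refine Filter.EventuallyEq.fderiv_eq ?_
    filter_upwards [(Continuous.prodMk_right u).continuousAt.preimage_mem_nhds
      (hs.mem_nhds huv)] with v' hv'
    exact (partialDifferential_eq_fderiv
      ((hg.contDiffAt (hs.mem_nhds hv')).differentiableAt (by simp))).symm
  -- `T` is block triangular, with diagonal blocks the identity and the Hessian.
  have hT : Function.Injective T := by
    rw [injective_iff_map_eq_zero]
    rintro ⟨a, b⟩ hab
    obtain ⟨h1, h2⟩ := Prod.ext_iff.1 hab
    have ha : a = 0 := h1
    subst ha
    have hb : b = 0 := hess b (by rw [hD]; exact h2)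
    rw [hb]; rfl
  have hrank : Module.finrank ℝ (E × E') = Module.finrank ℝ (E × (E' →L[ℝ] ℝ)) := by
    rw [Module.finrank_prod, Module.finrank_prod,
      ← (LinearMap.toContinuousLinearMap (𝕜 := ℝ) (E := E') (F' := ℝ)).finrank_eq,
      Subspace.dual_finrank_eq]
  let A : (E × E') ≃L[ℝ] (E × (E' →L[ℝ] ℝ)) :=
    (LinearEquiv.ofInjectiveOfFinrankEq (T : (E × E') →ₗ[ℝ] _) hT hrank).toContinuousLinearEquiv
  have hA : (A : (E × E') →L[ℝ] (E × (E' →L[ℝ] ℝ))) = T := by ext <;> rfl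
  exact exists_partialDiffeomorph_of_hasFDerivAt (by simp) hs (contDiffOn_fst.prodMk hG) huv A
    (hA ▸ hasFDerivAt_fst.prodMk hGd)

end Calculus

/-! ### Bundle charts and independence of the trivialisation. -/

section Charts

variable {EM : Type*} [NormedAddCommGroup EM] [NormedSpace ℝ EM]
  {HM : Type*} [TopologicalSpace HM] {IM : ModelWithCorners ℝ EM HM}
  {EB : Type*} [NormedAddCommGroup EB] [NormedSpace ℝ EB]
  {HB : Type*} [TopologicalSpace HB] {IB : ModelWithCorners ℝ EB HB}
  {EX : Type*} [NormedAddCommGroup EX] [NormedSpace ℝ EX]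
  {HX : Type*} [TopologicalSpace HX] {IX : ModelWithCorners ℝ EX HX}
  {M : Type*} [TopologicalSpace M] [ChartedSpace HM M]
  {B : Type*} [TopologicalSpace B] [ChartedSpace HB B]
  {X : Type*} [TopologicalSpace X] [ChartedSpace HX X]
  {π : M → B} {f : M → ℝ}

/-- The preferred extended chart of a boundaryless manifold, as a partial diffeomorphism. -/
def extChartPartialDiffeomorph (IX : ModelWithCorners ℝ EX HX) [IX.Boundaryless]
    (n : WithTop ℕ∞) [IsManifold IX n X] (x : X) :
    PartialDiffeomorph IX 𝓘(ℝ, EX) X EX n where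
  toPartialEquiv := extChartAt IX x
  open_source := isOpen_extChartAt_source x
  open_target := isOpen_extChartAt_target x
  contMDiffOn_toFun := by
    simpa only [extChartAt_source] using! contMDiffOn_extChartAt (I := IX) (n := n) (x := x)
  contMDiffOn_invFun := contMDiffOn_extChartAt_symm x

/-- A smooth trivialisation, as a partial diffeomorphism. -/
def IsSmoothTrivialization.partialDiffeomorph {e : Bundle.Trivialization X π}
    (he : IsSmoothTrivialization IM IB IX e) :
    PartialDiffeomorph IM (IB.prod IX) M (B × X) ∞ where
  toPartialEquiv := e.toPartialEquiv
  open_source := e.open_source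
  open_target := e.open_target
  contMDiffOn_toFun := he.contMDiffOn_toFun
  contMDiffOn_invFun := he.contMDiffOn_symm

/-- The chart of the total space given by a smooth trivialisation and charts of the base and of
the typical fibre. -/
def IsSmoothTrivialization.chart [IB.Boundaryless] [IX.Boundaryless] [IsManifold IB ∞ B]
    [IsManifold IX ∞ X] {e : Bundle.Trivialization X π}
    (he : IsSmoothTrivialization IM IB IX e) (b : B) (x : X) :
    PartialDiffeomorph IM 𝓘(ℝ, EB × EX) M (EB × EX) ∞ :=
  he.partialDiffeomorph.trans (extChartPartialDiffeomorph (IB.prod IX) ∞ (b, x))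

theorem contMDiff_fibreParam {e : Bundle.Trivialization X π}
    (he : IsSmoothTrivialization IM IB IX e) {b : B} (hb : b ∈ e.baseSet) :
    ContMDiff IX IM ∞ (fibreParam e b) := by
  rw [← contMDiffOn_univ]
  exact he.contMDiffOn_symm.comp
    (contMDiff_const.prodMk contMDiff_id).contMDiffOn fun x _ => e.mem_target.2 hb

/-- Chain rule; it serves both for changing the trivialisation and for passing between the fibre and
its charts. -/
theorem IsCriticalPoint.comp {h : X → ℝ} {g : M → X} {y : M}
    (hc : IsCriticalPoint IX h (g y)) (hh : MDifferentiableAt IX 𝓘(ℝ, ℝ) h (g y))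
    (hg : MDifferentiableAt IM IX g y) : IsCriticalPoint IM (h ∘ g) y := by
  unfold IsCriticalPoint at *
  rw [mfderiv_comp y hh hg, hc]
  exact ContinuousLinearMap.zero_comp _

/-- Being a fibre-wise critical point can be tested in a single smooth trivialisation. -/
theorem isFibrewiseCriticalPoint_iff (hf : ContMDiff IM 𝓘(ℝ, ℝ) ∞ f)
    {e : Bundle.Trivialization X π} (he : IsSmoothTrivialization IM IB IX e) {q : M}
    (hq : π q ∈ e.baseSet) :
    IsFibrewiseCriticalPoint IM IB IX X π f q ↔
      IsCriticalPoint IX (f ∘ fibreParam e (π q)) (e q).2 := by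
  refine ⟨fun h => h e he hq, fun h e' he' hq' => ?_⟩
  -- The change of trivialisation on the fibre over `π q`.
  let g : X → X := fun x => (e (fibreParam e' (π q) x)).2
  have hproj : ∀ x, π (fibreParam e' (π q) x) = π q := fun x => e'.proj_symm_apply' hq'
  have hsrc : ∀ x, fibreParam e' (π q) x ∈ e.source := fun x =>
    e.mem_source.2 (by rwa [hproj x])
  have hg : ContMDiff IX IX ∞ g := by
    rw [← contMDiffOn_univ]
    exact contMDiff_snd.comp_contMDiffOn (he.contMDiffOn_toFun.comp
      (contMDiff_fibreParam he' hq').contMDiffOn fun x _ => hsrc x)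
  have hcomp : f ∘ fibreParam e' (π q) = (f ∘ fibreParam e (π q)) ∘ g := by
    funext x
    have : fibreParam e (π q) (g x) = fibreParam e' (π q) x := by
      have := e.symm_apply_mk_proj (hsrc x)
      rwa [hproj x] at this
    simp only [Function.comp_apply, this]
  have hgq : g (e' q).2 = (e q).2 :=
    congrArg (fun z => (e z).2) (e'.symm_apply_mk_proj (e'.mem_source.2 hq'))
  rw [hcomp]
  exact IsCriticalPoint.comp (hgq ▸ h)
    ((hf.comp (contMDiff_fibreParam he hq)).mdifferentiableAt (by simp))
    (hg.mdifferentiableAt (by simp))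

end Charts

/-! ### The critical set in bundle charts. -/

section CriticalSet

variable {EM : Type*} [NormedAddCommGroup EM] [NormedSpace ℝ EM]
  {HM : Type*} [TopologicalSpace HM] {IM : ModelWithCorners ℝ EM HM}
  {EB : Type*} [NormedAddCommGroup EB] [NormedSpace ℝ EB]
  {HB : Type*} [TopologicalSpace HB] {IB : ModelWithCorners ℝ EB HB} [IB.Boundaryless]
  {EX : Type*} [NormedAddCommGroup EX] [NormedSpace ℝ EX]
  {HX : Type*} [TopologicalSpace HX] {IX : ModelWithCorners ℝ EX HX} [IX.Boundaryless]
  {M : Type*} [TopologicalSpace M] [ChartedSpace HM M]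
  {B : Type*} [TopologicalSpace B] [ChartedSpace HB B] [IsManifold IB ∞ B]
  {X : Type*} [TopologicalSpace X] [ChartedSpace HX X] [IsManifold IX ∞ X]
  {π : M → B} {f : M → ℝ} {e : Bundle.Trivialization X π}

theorem IsSmoothTrivialization.mem_chart_source (he : IsSmoothTrivialization IM IB IX e) {b : B}
    {x : X} {q : M} : q ∈ (he.chart b x).source ↔
      π q ∈ e.baseSet ∧ π q ∈ (extChartAt IB b).source ∧ (e q).2 ∈ (extChartAt IX x).source := by
  have h : q ∈ (he.chart b x).source ↔
      q ∈ e.source ∧ e q ∈ (extChartAt (IB.prod IX) (b, x)).source := Iff.rfl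
  rw [h, extChartAt_prod, PartialEquiv.prod_source, Set.mem_prod, e.mem_source]
  exact and_congr_right fun hq => by rw [e.coe_fst' hq]

theorem IsSmoothTrivialization.chart_apply (he : IsSmoothTrivialization IM IB IX e) {b : B}
    {x : X} {q : M} (hq : π q ∈ e.baseSet) :
    he.chart b x q = (extChartAt IB b (π q), extChartAt IX x (e q).2) := by
  rw [← e.coe_fst' hq]
  rfl

theorem IsSmoothTrivialization.chart_symm_apply (he : IsSmoothTrivialization IM IB IX e) {b : B}
    {x : X} (u : EB) (v : EX) :
    (he.chart b x).symm (u, v) =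
      fibreParam e ((extChartAt IB b).symm u) ((extChartAt IX x).symm v) := rfl

theorem IsSmoothTrivialization.contDiffOn_comp_chart_symm
    (he : IsSmoothTrivialization IM IB IX e) (hf : ContMDiff IM 𝓘(ℝ, ℝ) ∞ f) (b : B) (x : X) :
    ContDiffOn ℝ ∞ (f ∘ (he.chart b x).symm) (he.chart b x).target :=
  (hf.comp_contMDiffOn (he.chart b x).contMDiffOn_invFun).contDiffOn

/-- In the chart given by a smooth trivialisation, the fibre-wise critical points are the zeros of
the partial differential in the direction of the fibre. -/
theorem isFibrewiseCriticalPoint_iff_partialDifferential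
    (he : IsSmoothTrivialization IM IB IX e) (hf : ContMDiff IM 𝓘(ℝ, ℝ) ∞ f) {b : B} {x : X}
    {q : M} (hq : q ∈ (he.chart b x).source) :
    IsFibrewiseCriticalPoint IM IB IX X π f q ↔
      partialDifferential (f ∘ (he.chart b x).symm) (he.chart b x q) = 0 := by
  obtain ⟨hqe, hqb, hqx⟩ := he.mem_chart_source.1 hq
  have htgt : he.chart b x q ∈ (he.chart b x).target := (he.chart b x).map_source hq
  have hd : DifferentiableAt ℝ (f ∘ (he.chart b x).symm) (he.chart b x q) :=
    ((he.contDiffOn_comp_chart_symm hf b x).contDiffAt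
      ((he.chart b x).open_target.mem_nhds htgt)).differentiableAt (by simp)
  have hvt : extChartAt IX x (e q).2 ∈ (extChartAt IX x).target :=
    (extChartAt IX x).map_source hqx
  have hv : (extChartAt IX x).symm (extChartAt IX x (e q).2) = (e q).2 :=
    (extChartAt IX x).left_inv hqx
  rw [he.chart_apply hqe] at hd ⊢
  have hslice : (fun v => (f ∘ (he.chart b x).symm) (extChartAt IB b (π q), v)) =
      (f ∘ fibreParam e (π q)) ∘ (extChartAt IX x).symm := by
    funext v
    simp only [Function.comp_apply, he.chart_symm_apply, (extChartAt IB b).left_inv hqb]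
  rw [isFibrewiseCriticalPoint_iff hf he hqe, partialDifferential_eq_fderiv hd, hslice,
    ← mfderiv_eq_fderiv]
  have hh : ContMDiff IX 𝓘(ℝ, ℝ) ∞ (f ∘ fibreParam e (π q)) :=
    hf.comp (contMDiff_fibreParam he hqe)
  have hsymm : MDifferentiableAt 𝓘(ℝ, EX) IX (extChartAt IX x).symm
      (extChartAt IX x (e q).2) :=
    ((contMDiffOn_extChartAt_symm (n := ∞) x).contMDiffAt
      ((isOpen_extChartAt_target x).mem_nhds hvt)).mdifferentiableAt (by simp)
  have hchart : MDifferentiableAt IX 𝓘(ℝ, EX) (extChartAt IX x) (e q).2 :=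
    ((extChartPartialDiffeomorph IX ∞ x).mdifferentiableAt (by simp) hqx)
  constructor
  · intro hc
    exact IsCriticalPoint.comp (hv.symm ▸ hc) (hh.mdifferentiableAt (by simp)) hsymm
  · intro hc
    -- Composing with the chart undoes its inverse only near `(e q).2`, which suffices for the
    -- differential.
    have hcomp := IsCriticalPoint.comp (IX := 𝓘(ℝ, EX)) (g := extChartAt IX x) (y := (e q).2) hc
      ((hh.mdifferentiableAt (by simp)).comp _ hsymm) hchart
    unfold IsCriticalPoint at hcomp ⊢
    have hev : (f ∘ fibreParam e (π q)) =ᶠ[𝓝 (e q).2]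
        ((f ∘ fibreParam e (π q)) ∘ (extChartAt IX x).symm) ∘ extChartAt IX x := by
      filter_upwards [(isOpen_extChartAt_source (I := IX) x).mem_nhds hqx] with z hz
      simp only [Function.comp_apply, (extChartAt IX x).left_inv hz]
    exact hev.mfderiv_eq.trans hcomp

/-- Near a point of the critical set of a fibre-wise Morse function there is a chart in which the
critical set is a slice and whose first component is a chart of the base. -/
theorem exists_slice_fibrewiseCriticalSet [FiniteDimensional ℝ EB] [FiniteDimensional ℝ EX]
    (hπ : IsSmoothFibreBundle IM IB IX X π) (hf : IsFibrewiseMorse IM IB IX X π f) {p : M}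
    (hp : p ∈ fibrewiseCriticalSet IM IB IX X π f) :
    ∃ ψ : PartialDiffeomorph IM 𝓘(ℝ, EB × (EX →L[ℝ] ℝ)) M (EB × (EX →L[ℝ] ℝ)) ∞,
      p ∈ ψ.source ∧
      (∀ q ∈ ψ.source, q ∈ fibrewiseCriticalSet IM IB IX X π f ↔ (ψ q).2 = 0) ∧
      ∀ q ∈ ψ.source, π q ∈ (extChartAt IB (π p)).source ∧
        (ψ q).1 = extChartAt IB (π p) (π q) := by
  obtain ⟨e, hpe, he⟩ := hπ.exists_trivialization (π p)
  let c := he.chart (π p) (e p).2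
  have hpc : p ∈ c.source :=
    he.mem_chart_source.2 ⟨hpe, mem_extChartAt_source _, mem_extChartAt_source _⟩
  have hcp : c p = (extChartAt IB (π p) (π p), extChartAt IX (e p).2 (e p).2) :=
    he.chart_apply hpe
  have hslice : (fun v => (f ∘ c.symm) (extChartAt IB (π p) (π p), v)) =
      (f ∘ fibreParam e (π p)) ∘ (extChartAt IX (e p).2).symm := by
    funext v
    simp only [c, Function.comp_apply, he.chart_symm_apply, extChartAt_to_inv]
  obtain ⟨Φ, hpΦ, hΦc, hΦ⟩ := exists_partialDiffeomorph_of_hessian c.open_target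
    (he.contDiffOn_comp_chart_symm hf.contMDiff (π p) (e p).2)
    (u := extChartAt IB (π p) (π p)) (v := extChartAt IX (e p).2 (e p).2)
    (hcp ▸ c.map_source hpc) fun w hw => by
      refine hf.nondegenerate p hp e he hpe w fun w' => ?_
      rw [hessian, ← hslice, hw]
      rfl
  have hsrc : ∀ q ∈ (c.trans Φ).source, q ∈ c.source := fun q hq => hq.1
  have hval : ∀ q, c.trans Φ q = ((c q).1, partialDifferential (f ∘ c.symm) (c q)) :=
    fun q => hΦ (c q)
  have hcpΦ : c p ∈ Φ.source := by rwa [hcp]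
  refine ⟨c.trans Φ, ⟨hpc, hcpΦ⟩, fun q hq => ?_, fun q hq => ?_⟩
  · rw [hval]
    exact isFibrewiseCriticalPoint_iff_partialDifferential he hf.contMDiff (hsrc q hq)
  · obtain ⟨hqe, hqb, -⟩ := he.mem_chart_source.1 (hsrc q hq)
    refine ⟨hqb, ?_⟩
    rw [hval, he.chart_apply hqe]

end CriticalSet

/-! ### Transversality from a local section. -/

section Transversality

variable {EM : Type*} [NormedAddCommGroup EM] [NormedSpace ℝ EM]
  {HM : Type*} [TopologicalSpace HM] {IM : ModelWithCorners ℝ EM HM}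
  {EB : Type*} [NormedAddCommGroup EB] [NormedSpace ℝ EB]
  {HB : Type*} [TopologicalSpace HB] {IB : ModelWithCorners ℝ EB HB}
  {M : Type*} [TopologicalSpace M] [ChartedSpace HM M]
  {B : Type*} [TopologicalSpace B] [ChartedSpace HB B]
  {π : M → B}

/-- A submanifold through which `π` has a local smooth section is transverse to the fibre. -/
theorem submanifoldTangentSpace_sup_fibreTangentSpace {d : ℕ} {N : Set M}
    [ChartedSpace (EuclideanSpace ℝ (Fin d)) N]
    (hN : Manifold.IsSmoothEmbedding (𝓡 d) IM ∞ (Subtype.val : N → M))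
    (hπ : ContMDiff IM IB ∞ π) {b : B} {s : B → N} {p : N} (hsb : s b = p)
    (hs : ContinuousAt s b)
    (hs' : ContMDiffAt IB IM ∞ (Subtype.val ∘ s) b)
    (hsec : ∀ᶠ b' in 𝓝 b, π (s b') = b') :
    submanifoldTangentSpace IM d N p ⊔ fibreTangentSpace IM IB π (p : M) = ⊤ := by
  subst hsb
  -- A continuous map into `N` is smooth once its composite with the immersion into `M` is.
  have hsm : MDifferentiableAt IB (𝓡 d) s b :=
    ((ContMDiffAt.iff_comp_isImmersionAt (hN.isImmersion.isImmersionAt (s b))).2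
      ⟨hs, hs'⟩).mdifferentiableAt (by simp)
  have hι : MDifferentiableAt (𝓡 d) IM (Subtype.val : N → M) (s b) :=
    hN.contMDiff.mdifferentiableAt (by simp)
  have hπd : MDifferentiableAt IM IB π (s b : M) := hπ.mdifferentiableAt (by simp)
  have hid : HasMFDerivAt IB IB (fun b' => π (s b')) b
      (ContinuousLinearMap.id ℝ (TangentSpace IB b)) :=
    (hasMFDerivAt_id b).congr_of_eventuallyEq hsec
  have hchain := hπd.hasMFDerivAt.comp b (hι.hasMFDerivAt.comp b hsm.hasMFDerivAt)
  have heq := hasMFDerivAt_unique hchain hid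
  rw [eq_top_iff]
  intro v _
  set w := mfderiv IM IB π (s b : M) v with hw
  -- The lift of `dπ v` along the section: it lies in `T_pN`, and `v - v₁` is vertical.
  set v₁ := mfderiv (𝓡 d) IM (Subtype.val : N → M) (s b) (mfderiv IB (𝓡 d) s b w) with hv₁
  have h1 : mfderiv IM IB π (s b : M) v₁ = w := DFunLike.congr_fun heq w
  rw [← add_sub_cancel v₁ v]
  refine Submodule.add_mem_sup ⟨_, rfl⟩ ?_
  change mfderiv IM IB π (s b : M) (v - v₁) = 0
  rw [map_sub, h1, hw, sub_self]

end Transversality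

end FibreMorse

end

/-! ### Assembly of the main theorem. -/

theorem mainTheorem1
    {EM : Type*} [NormedAddCommGroup EM] [NormedSpace ℝ EM] [FiniteDimensional ℝ EM]
    {HM : Type*} [TopologicalSpace HM] (IM : ModelWithCorners ℝ EM HM) [IM.Boundaryless]
    {EΘ : Type*} [NormedAddCommGroup EΘ] [NormedSpace ℝ EΘ] [FiniteDimensional ℝ EΘ]
    {HΘ : Type*} [TopologicalSpace HΘ] (IΘ : ModelWithCorners ℝ EΘ HΘ) [IΘ.Boundaryless]
    {EX : Type*} [NormedAddCommGroup EX] [NormedSpace ℝ EX] [FiniteDimensional ℝ EX]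
    {HX : Type*} [TopologicalSpace HX] (IX : ModelWithCorners ℝ EX HX) [IX.Boundaryless]
    (M : Type*) [TopologicalSpace M] [T2Space M] [CompactSpace M]
    [ChartedSpace HM M] [IsManifold IM ∞ M]
    (Θ : Type*) [TopologicalSpace Θ] [T2Space Θ] [CompactSpace Θ]
    [ChartedSpace HΘ Θ] [IsManifold IΘ ∞ Θ]
    (X : Type*) [TopologicalSpace X] [T2Space X] [CompactSpace X]
    [ChartedSpace HX X] [IsManifold IX ∞ X]
    (π : M → Θ) (hπ : FibreMorse.IsSmoothFibreBundle IM IΘ IX X π)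
    (f : M → ℝ) (hf : FibreMorse.IsFibrewiseMorse IM IΘ IX X π f) :
    ∃ _ : ChartedSpace (EuclideanSpace ℝ (Fin (Module.finrank ℝ EΘ)))
        (FibreMorse.fibrewiseCriticalSet IM IΘ IX X π f),
      -- `N` is an embedded submanifold of `M`, of dimension `dim Θ`
      IsManifold (𝓡 (Module.finrank ℝ EΘ)) ∞
        (FibreMorse.fibrewiseCriticalSet IM IΘ IX X π f) ∧
      Manifold.IsSmoothEmbedding (𝓡 (Module.finrank ℝ EΘ)) IM ∞
        (Subtype.val : FibreMorse.fibrewiseCriticalSet IM IΘ IX X π f → M) ∧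
      -- `N` meets every fibre transversally
      ∀ (θ : Θ) (p : FibreMorse.fibrewiseCriticalSet IM IΘ IX X π f), π p = θ →
        FibreMorse.submanifoldTangentSpace IM (Module.finrank ℝ EΘ)
            (FibreMorse.fibrewiseCriticalSet IM IΘ IX X π f) p ⊔
          FibreMorse.fibreTangentSpace IM IΘ π (p : M) = ⊤ := by
  have hslice : ∀ p ∈ FibreMorse.fibrewiseCriticalSet IM IΘ IX X π f,
      ∃ ψ : PartialDiffeomorph IM
          𝓘(ℝ, EuclideanSpace ℝ (Fin (Module.finrank ℝ EΘ)) × (EX →L[ℝ] ℝ)) M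
          (EuclideanSpace ℝ (Fin (Module.finrank ℝ EΘ)) × (EX →L[ℝ] ℝ)) ∞,
        p ∈ ψ.source ∧
        (∀ q ∈ ψ.source, q ∈ FibreMorse.fibrewiseCriticalSet IM IΘ IX X π f ↔ (ψ q).2 = 0) ∧
        ∀ q ∈ ψ.source, π q ∈ (extChartAt IΘ (π p)).source ∧
          (ψ q).1 = toEuclidean (extChartAt IΘ (π p) (π q)) := by
    intro p hp
    obtain ⟨ψ, hpψ, hψ, hψπ⟩ := FibreMorse.exists_slice_fibrewiseCriticalSet hπ hf hp
    -- `toEuclidean` replaces the model space of the base by `ℝᵈ`, with `d = dim Θ`.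
    refine ⟨ψ.trans (FibreMorse.linearPartialDiffeomorph ∞
      (toEuclidean.prodCongr (ContinuousLinearEquiv.refl ℝ (EX →L[ℝ] ℝ)))),
      ⟨hpψ, Set.mem_univ _⟩, fun q hq => hψ q hq.1, fun q hq => ⟨(hψπ q hq.1).1, ?_⟩⟩
    exact congrArg toEuclidean (hψπ q hq.1).2
  obtain ⟨cs, hman, hemb⟩ := FibreMorse.exists_isSmoothEmbedding_of_slices (by simp)
    fun p hp => (hslice p hp).imp fun ψ h => ⟨h.1, h.2.1⟩
  refine ⟨cs, hman, hemb, ?_⟩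
  rintro θ p rfl
  obtain ⟨ψ, hpψ, hψ, hψπ⟩ := hslice p p.2
  -- This chart need not belong to the atlas `cs`, so the section `φ.symm ∘ g` is checked to be
  -- continuous into `N` and smooth only as a map into `M`.
  let φ := FibreMorse.sliceChart ψ.toOpenPartialHomeomorph hψ p
  let g : Θ → EuclideanSpace ℝ (Fin (Module.finrank ℝ EΘ)) :=
    fun θ => toEuclidean (extChartAt IΘ (π p) θ)
  have hgp : g (π p) = φ p := (hψπ p hpψ).2.symm
  have hφp : φ p ∈ φ.target := φ.map_source hpψ
  have hg : ContMDiffAt IΘ (𝓡 (Module.finrank ℝ EΘ)) ∞ g (π p) :=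
    (toEuclidean (E := EΘ)).contDiff.contMDiff.contMDiffAt.comp (π p) contMDiffAt_extChartAt
  have hgt : ∀ᶠ θ in 𝓝 (π p), g θ ∈ φ.target :=
    hg.continuousAt.preimage_mem_nhds (φ.open_target.mem_nhds (hgp ▸ hφp))
  have hsymm : ∀ y ∈ φ.target, (φ.symm y : M) = ψ.symm (y, 0) :=
    fun y hy => FibreMorse.coe_sliceChart_symm hy
  refine FibreMorse.submanifoldTangentSpace_sup_fibreTangentSpace hemb hπ.contMDiff
    (b := π p) (s := fun θ => φ.symm (g θ)) ?_ ?_ ?_ ?_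
  · rw [hgp, φ.left_inv hpψ]
  · exact (φ.continuousAt_symm (hgp ▸ hφp)).comp hg.continuousAt
  · have hψs : ContMDiffAt 𝓘(ℝ, EuclideanSpace ℝ (Fin (Module.finrank ℝ EΘ)) × (EX →L[ℝ] ℝ))
        IM ∞ ψ.symm (g (π p), 0) :=
      ψ.contMDiffOn_invFun.contMDiffAt (ψ.open_target.mem_nhds hgt.self_of_nhds)
    have hpair : ContMDiff (𝓡 (Module.finrank ℝ EΘ))
        𝓘(ℝ, EuclideanSpace ℝ (Fin (Module.finrank ℝ EΘ)) × (EX →L[ℝ] ℝ)) ∞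
        (fun y => (y, (0 : EX →L[ℝ] ℝ))) :=
      (contDiff_id.prodMk contDiff_const).contMDiff
    refine ContMDiffAt.congr_of_eventuallyEq
      (hψs.comp (π p) (hpair.contMDiffAt.comp (π p) hg)) ?_
    filter_upwards [hgt] with θ hθ
    exact hsymm _ hθ
  · filter_upwards [hgt, extChartAt_source_mem_nhds (I := IΘ) (π p)] with θ hθ hθs
    have hq : ((φ.symm (g θ) : _) : M) ∈ ψ.source := φ.map_target hθ
    have h1 : toEuclidean (extChartAt IΘ (π p) (π (φ.symm (g θ)))) = g θ :=
      (hψπ _ hq).2.symm.trans (φ.right_inv hθ)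
    -- The section property: both base points have the same coordinates in one chart.
    exact (extChartAt IΘ (π p)).injOn (hψπ _ hq).1 hθs (toEuclidean.injective h1)
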